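/- For $F:\{0,1\}^m\to\{0,1\}$ and $k\ge 1$, let $F_k:\{0,1\}^m\to\mathbb{Z}/2^k\mathbb{Z}$ be the $k$-lift of $F$: $F_k(x)=0$ if $F(x)=0$ and $F_k(x)=2^{k-1}$ if $F(x)=1$. Let $$\gamma_{d,k}(F)=\max_{Q}\ \Pr_{x\sim\{0,1\}^m}\bigl[F_k(x)=Q(x)\bigr],$$ where $x$ is uniform and $Q$ ranges over the multilinear polynomials in $\mathbb{Z}/2^k\mathbb{Z}[x_1,\dots,x_m]$ of degree at most $d$. **Theorem.** Let $d\in\mathbb{N}$ be a power of $2$ (including $d=1$). There is a sequence $\varepsilon_n\to 0$ of real numbers (depending only on $d$) such that for all large enough $n$ there exists a function $F:\{0,1\}^{2n}\to\{0,1\}$ with $$\gamma_{2d,2}(F)\ \ge\ \tfrac34-\varepsilon_n,\qquad \gamma_{3d-1,1}(F)\ \le\ \tfrac58+\varepsilon_n,$$ and $\gamma_{3d-1,1}(F)<\gamma_{2d,2}(F)$. In particular ($d=1$), for all large enough $n$ there is $F:\{0,1\}^{2n}\to\{0,1\}$ with $\gamma_{2,2}(F)>\gamma_{2,1}(F)$.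 -/

import Mathlib

open Filter Topology

namespace BoolApprox

/-- The `k`-lift of a Boolean function: the value `0` stays `0`, the value `1` becomes `2^(k-1)` in
`ℤ/2^kℤ`. -/
def lift {ι : Type*} (k : ℕ) (F : (ι → Bool) → Bool) : (ι → Bool) → ZMod (2 ^ k) :=
  fun x => if F x then 2 ^ (k - 1) else 0

/-- The multilinear polynomials of degree at most `d` over `ℤ/2^kℤ`. -/
def multilinearPolys (ι : Type*) (d k : ℕ) : Set (MvPolynomial ι (ZMod (2 ^ k))) :=
  {Q | (∀ i, Q.degreeOf i ≤ 1) ∧ Q.totalDegree ≤ d}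

/-- The function on `{0,1}^ι` computed by a polynomial. -/
noncomputable def polyFun {ι R : Type*} [CommSemiring R] (Q : MvPolynomial ι R) :
    (ι → Bool) → R :=
  fun x => MvPolynomial.eval (fun i => if x i then 1 else 0) Q

/-- The agreement of two functions on a finite domain: the fraction of inputs where they agree. -/
noncomputable def agr {D R : Type*} [Fintype D] [DecidableEq R] (f g : D → R) : ℝ :=
  ((Finset.univ.filter fun x => f x = g x).card : ℝ) / (Fintype.card D : ℝ)

/-- `gamma d k F` is the largest agreement of the `k`-lift of `F` with a multilinear polynomial of
degree at most `d` over `ℤ/2^kℤ` (the supremum is attained, see `isGreatest_gamma`). -/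
noncomputable def gamma {ι : Type*} [Fintype ι] [DecidableEq ι] (d k : ℕ)
    (F : (ι → Bool) → Bool) : ℝ :=
  sSup ((fun Q => agr (lift k F) (polyFun Q)) '' multilinearPolys ι d k)

theorem isGreatest_gamma {ι : Type*} [Fintype ι] [DecidableEq ι] (d k : ℕ)
    (F : (ι → Bool) → Bool) :
    IsGreatest ((fun Q => agr (lift k F) (polyFun Q)) '' multilinearPolys ι d k)
      (gamma d k F) := by
  have hne : ((fun Q => agr (lift k F) (polyFun Q)) '' multilinearPolys ι d k).Nonempty :=
    ⟨_, 0, by simp [multilinearPolys], rfl⟩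
  have hfin : ((fun Q => agr (lift k F) (polyFun Q)) '' multilinearPolys ι d k).Finite := by
    refine (Set.finite_range fun s : Finset (ι → Bool) =>
      (s.card : ℝ) / (Fintype.card (ι → Bool) : ℝ)).subset ?_
    rintro _ ⟨Q, -, rfl⟩
    exact ⟨_, rfl⟩
  exact ⟨hne.csSup_mem hfin, fun _ h => le_csSup hfin.bddAbove h⟩

end BoolApprox

namespace BoolApprox

/-! Split the variables into two blocks of size `n` and let `F` be `e_d(x) e_{2d}(y) + e_{2d}(x)
e_d(y)` mod 2, with `d = 2^l`.

Lower bound: modulo 4, `C(x,d) = 2 C(x,2d)` whenever `C(x,d)` is even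
(`choose_two_pow_eq_two_mul_choose`). Hence `e_d(x) e_d(y)`, of degree `2d`, equals the lift of `F`
unless both `C(|x|,d)` and `C(|y|,d)` are odd. Each of these is bit `l` of a block weight, so the
exceptional set has density about `1/4`.

Upper bound: if `Q` over `ℤ/2` has degree below `3d`, agreement of `F` and `Q` means a zero of `F +
Q`, whose part of degree `3d` is that of `F`. Ramsey's theorem yields large subblocks on which the
coefficients of a given degree depend only on the sizes in the two blocks. Fixing the outside
variables in any way keeps the top part, and the proportion of zeros is the average over these
restrictions. Descending through the degrees (`ZeroBound.succ`) reduces to polynomials symmetric in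
each block. Such a polynomial depends only on the weights mod `4d`, which are nearly uniform. By
Lucas, with the weights mod `d` fixed, it is a cubic in the next two bits of each weight with top
part `i C(k,2) + C(i,2) k`. A finite check gives at most 10 zeros among 16 points, hence `5/8`. -/

/-! ### Ramsey theorems for finite colourings of subsets. -/

/-- Induction on `k`: repeatedly splitting off the least point and applying the case `k` to its link
gives a set on which the colour of a `(k+1)`-subset depends only on its minimum. The pigeonhole
principle on the minima finishes. -/
theorem exists_monochromatic_subset (k : ℕ) : ∀ m q : ℕ, ∃ N : ℕ,
    ∀ (α : Type) [LinearOrder α] (κ : Type) [Fintype κ], Fintype.card κ ≤ q →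
      ∀ (A : Finset α) (c : Finset α → κ), N ≤ A.card →
        ∃ H ⊆ A, H.card = m ∧ ∃ g : κ, ∀ S ⊆ H, S.card = k → c S = g := by
  induction k with
  | zero =>
    intro m q
    refine ⟨m, fun α _ κ _ _ A c hA => ?_⟩
    obtain ⟨H, hH, hm⟩ := Finset.exists_subset_card_eq hA
    refine ⟨H, hH, hm, c ∅, fun S _ hS => ?_⟩
    rw [Finset.card_eq_zero.1 hS]
  | succ k ih =>
    intro m q
    have aux : ∀ t : ℕ, ∃ N : ℕ,
        ∀ (α : Type) [LinearOrder α] (κ : Type) [Fintype κ], Fintype.card κ ≤ q →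
          ∀ (A : Finset α) (c : Finset α → κ), N ≤ A.card →
            ∃ H ⊆ A, H.card = t ∧ ∃ f : α → κ,
              ∀ S ⊆ H, ∀ a ∈ S, (∀ b ∈ S, a ≤ b) → S.card = k + 1 → c S = f a := by
      intro t
      induction t with
      | zero =>
        refine ⟨0, fun α _ κ _ _ A c _ => ⟨∅, by simp, by simp, fun _ => c ∅, ?_⟩⟩
        intro S hS a ha
        exact absurd (hS ha) (by simp)
      | succ t iht =>
        obtain ⟨N₁, h₁⟩ := iht
        obtain ⟨N₂, h₂⟩ := ih N₁ q
        refine ⟨N₂ + 1, fun α _ κ _ hκ A c hA => ?_⟩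
        have hne : A.Nonempty := Finset.card_pos.1 (by omega)
        set a₀ := A.min' hne with ha₀
        have ha₀A : a₀ ∈ A := A.min'_mem hne
        obtain ⟨H₁, hH₁, hc₁, g, hg⟩ := h₂ α κ hκ (A.erase a₀) (fun S => c (insert a₀ S))
          (by rw [Finset.card_erase_of_mem ha₀A]; omega)
        obtain ⟨H₂, hH₂, hc₂, f, hf⟩ := h₁ α κ hκ H₁ c hc₁.ge
        have hsub : H₂ ⊆ A.erase a₀ := hH₂.trans hH₁
        have hnot : a₀ ∉ H₂ := fun h => by simpa using hsub h
        refine ⟨insert a₀ H₂, ?_, ?_, Function.update f a₀ g, ?_⟩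
        · exact Finset.insert_subset ha₀A (hsub.trans (Finset.erase_subset _ _))
        · rw [Finset.card_insert_of_notMem hnot, hc₂]
        · intro S hS a ha hmin hcard
          by_cases h : a = a₀
          · rw [h] at ha ⊢
            rw [Function.update_self]
            have hsub' : S.erase a₀ ⊆ H₁ := fun x hx =>
              hH₂ ((Finset.mem_insert.1 (hS (Finset.mem_of_mem_erase hx))).resolve_left
                (Finset.ne_of_mem_erase hx))
            have := hg (S.erase a₀) hsub' (by rw [Finset.card_erase_of_mem ha, hcard]; rfl)
            rwa [Finset.insert_erase ha] at this
          · rw [Function.update_of_ne h]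
            have haH : a ∈ H₂ := (Finset.mem_insert.1 (hS ha)).resolve_left h
            have hle : a₀ ≤ a := A.min'_le _ (Finset.mem_of_mem_erase (hsub haH))
            have ha₀S : a₀ ∉ S := fun h' => h (le_antisymm (hmin _ h') hle)
            exact hf S ((Finset.subset_insert_iff_of_notMem ha₀S).1 hS) a ha hmin hcard
    obtain ⟨N, hN⟩ := aux (q * m)
    refine ⟨N, fun α _ κ _ hκ A c hA => ?_⟩
    classical
    obtain ⟨H, hH, hcard, f, hf⟩ := hN α κ hκ A c hA
    obtain ⟨g, -, hg⟩ := Finset.exists_le_card_fiber_of_mul_le_card_of_maps_to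
      (s := H) (t := (Finset.univ : Finset κ)) (f := f) (n := m) (by simp)
      ⟨c ∅, by simp⟩ (by rw [hcard]; exact Nat.mul_le_mul_right _ hκ)
    obtain ⟨H', hH', hm⟩ := Finset.exists_subset_card_eq hg
    refine ⟨H', hH'.trans ((Finset.filter_subset _ _).trans hH), hm, g, fun S hS hk => ?_⟩
    have hne : S.Nonempty := Finset.card_pos.1 (by omega)
    rw [hf S (hS.trans (hH'.trans (Finset.filter_subset _ _))) (S.min' hne) (S.min'_mem hne)
      (fun b hb => S.min'_le b hb) hk]
    exact (Finset.mem_filter.1 (hH' (hS (S.min'_mem hne)))).2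

theorem exists_subset_color_eq_card (k : ℕ) : ∀ m q : ℕ, ∃ N : ℕ,
    ∀ (α : Type) [LinearOrder α] (κ : Type) [Fintype κ], Fintype.card κ ≤ q →
      ∀ (A : Finset α) (c : Finset α → κ), N ≤ A.card →
        ∃ H ⊆ A, H.card = m ∧ ∃ g : ℕ → κ, ∀ S ⊆ H, S.card < k → c S = g S.card := by
  induction k with
  | zero =>
    intro m q
    refine ⟨m, fun α _ κ _ _ A c hA => ?_⟩
    obtain ⟨H, hH, hm⟩ := Finset.exists_subset_card_eq hA
    exact ⟨H, hH, hm, fun _ => c ∅, fun S _ hS => absurd hS (by simp)⟩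
  | succ k ih =>
    intro m q
    obtain ⟨N₁, h₁⟩ := ih m q
    obtain ⟨N₂, h₂⟩ := exists_monochromatic_subset k N₁ q
    refine ⟨N₂, fun α _ κ _ hκ A c hA => ?_⟩
    obtain ⟨H₁, hH₁, hc₁, g₁, hg₁⟩ := h₂ α κ hκ A c hA
    obtain ⟨H₂, hH₂, hc₂, g₂, hg₂⟩ := h₁ α κ hκ H₁ c hc₁.ge
    refine ⟨H₂, hH₂.trans hH₁, hc₂, Function.update g₂ k g₁, fun S hS hk => ?_⟩
    by_cases h : S.card = k
    · rw [h, Function.update_self, hg₁ S (hS.trans hH₂) h]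
    · rw [Function.update_of_ne h, hg₂ S hS (by omega)]

theorem exists_subsets_color_eq_card (k m : ℕ) : ∃ N : ℕ,
    ∀ (α : Type) [LinearOrder α] (A B : Finset α) (c : Finset α → Finset α → ZMod 2),
      N ≤ A.card → N ≤ B.card →
        ∃ A' ⊆ A, ∃ B' ⊆ B, A'.card = m ∧ B'.card = m ∧ ∃ g : ℕ → ℕ → ZMod 2,
          ∀ S ⊆ A', ∀ T ⊆ B', S.card < k → T.card < k → c S T = g S.card T.card := by
  obtain ⟨M, hM⟩ := exists_subset_color_eq_card k m (Fintype.card (Fin k → ZMod 2))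
  -- With `M` points `B₁` of the second block fixed, `S` is coloured by the whole function `T ↦ c S
  -- T` on the `2 ^ M` subsets of `B₁`. Then `T` is coloured by its values over the possible sizes
  -- of `S`.
  obtain ⟨N, hN⟩ := exists_subset_color_eq_card k m (2 ^ 2 ^ M)
  refine ⟨max M N, fun α _ A B c hA hB => ?_⟩
  obtain ⟨B₁, hB₁, hBM⟩ := Finset.exists_subset_card_eq ((le_max_left M N).trans hB)
  obtain ⟨A', hA', hAm, g₁, hg₁⟩ := hN α (B₁.powerset → ZMod 2) (by simp [ZMod.card, hBM]) A
    (fun S T => c S T) ((le_max_right M N).trans hA)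
  obtain ⟨B', hB', hBm, g₂, hg₂⟩ := hM α (Fin k → ZMod 2) le_rfl B₁
    (fun T a => if hT : T ∈ B₁.powerset then g₁ a ⟨T, hT⟩ else 0) hBM.ge
  refine ⟨A', hA', B', hB'.trans hB₁, hAm, hBm,
    fun a b => if ha : a < k then g₂ b ⟨a, ha⟩ else 0, fun S hS T hT hSk hTk => ?_⟩
  have hT₁ : T ∈ B₁.powerset := Finset.mem_powerset.2 (hT.trans hB')
  have e₁ := congrFun (hg₁ S hS hSk) ⟨T, hT₁⟩
  have e₂ := congrFun (hg₂ T hT hTk) ⟨S.card, hSk⟩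
  simp only [hT₁, dite_true] at e₂
  simp only [hSk, dite_true]
  rw [← e₂, ← e₁]

/-! ### Restricting variables, and descent to symmetric polynomials. -/

theorem sum_powerset_union {α M : Type*} [DecidableEq α] [AddCommMonoid M] {X Z : Finset α}
    (h : Disjoint X Z) (f : Finset α → M) :
    ∑ S ∈ (X ∪ Z).powerset, f S = ∑ S ∈ X.powerset, ∑ U ∈ Z.powerset, f (S ∪ U) := by
  induction Z using Finset.induction_on generalizing f with
  | empty => simp
  | insert a Z ha ih =>
    have haX : a ∉ X := fun h' => Finset.disjoint_left.1 h h' (Finset.mem_insert_self _ _)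
    have hd : Disjoint X Z := h.mono_right (Finset.subset_insert _ _)
    rw [Finset.union_insert, Finset.sum_powerset_insert (by simp [haX, ha]), ih hd, ih hd,
      ← Finset.sum_add_distrib]
    refine Finset.sum_congr rfl fun S _ => ?_
    rw [Finset.sum_powerset_insert ha]
    simp [Finset.union_insert]

/-- The value at `(X, Y)` of the polynomial over `ℤ/2ℤ` with coefficients `c`, in two blocks of
variables. -/
def bieval {α : Type*} (c : Finset α → Finset α → ZMod 2) (X Y : Finset α) : ZMod 2 :=
  ∑ S ∈ X.powerset, ∑ T ∈ Y.powerset, c S T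

/-- The coefficients left after the variables in `Z` and `W` are set to `1`. -/
def specialize {α : Type*} [DecidableEq α] (c : Finset α → Finset α → ZMod 2) (Z W : Finset α) :
    Finset α → Finset α → ZMod 2 :=
  fun S T => ∑ U ∈ Z.powerset, ∑ V ∈ W.powerset, c (S ∪ U) (T ∪ V)

theorem bieval_union {α : Type*} [DecidableEq α] (c : Finset α → Finset α → ZMod 2)
    {X Z Y W : Finset α} (h₁ : Disjoint X Z) (h₂ : Disjoint Y W) :
    bieval c (X ∪ Z) (Y ∪ W) = bieval (specialize c Z W) X Y := by
  unfold bieval specialize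
  rw [sum_powerset_union h₁]
  refine Finset.sum_congr rfl fun S _ => ?_
  simp_rw [sum_powerset_union h₂]
  rw [Finset.sum_comm]

/-- Coefficients of a polynomial of degree `3 * d` with top part `e_d(x) e_{2d}(y) + e_{2d}(x) e_d(y)`
whose coefficients in degrees at least `j` are symmetric in each block. -/
structure Admissible {α : Type*} (d j : ℕ) (A B : Finset α) (c : Finset α → Finset α → ZMod 2) :
    Prop where
  vanish : ∀ S ⊆ A, ∀ T ⊆ B, 3 * d < S.card + T.card → c S T = 0
  top : ∀ S ⊆ A, ∀ T ⊆ B, S.card + T.card = 3 * d →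
    c S T = if S.card = d ∨ S.card = 2 * d then 1 else 0
  symm : ∃ g : ℕ → ℕ → ZMod 2, ∀ S ⊆ A, ∀ T ⊆ B, j ≤ S.card + T.card → c S T = g S.card T.card

/-- Setting variables to constants only feeds coefficients of higher degree into lower ones. The top
part is therefore unchanged, and symmetry in degrees above `j`, together with symmetry in degree `j`
on the subblocks, survives. -/
theorem Admissible.specialize {α : Type*} [DecidableEq α] {d j : ℕ} {A B A' B' Z W : Finset α}
    {c : Finset α → Finset α → ZMod 2} (h : Admissible d (j + 1) A B c) (hA : A' ⊆ A) (hB : B' ⊆ B)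
    {g : ℕ → ℕ → ZMod 2}
    (hg : ∀ S ⊆ A', ∀ T ⊆ B', S.card + T.card = j → c S T = g S.card T.card)
    (hZ : Z ⊆ A \ A') (hW : W ⊆ B \ B') : Admissible d j A' B' (specialize c Z W) := by
  have hcard : ∀ {P Q R U : Finset α}, U ⊆ R → R ⊆ P \ Q → ∀ S ⊆ Q,
      (S ∪ U).card = S.card + U.card := by
    intro P Q R U hU hR S hS
    refine Finset.card_union_of_disjoint (Finset.disjoint_of_subset_left hS ?_)
    exact (Finset.disjoint_sdiff).mono_right (hU.trans hR)
  have hsub : ∀ {P Q R U : Finset α}, U ⊆ R → R ⊆ P \ Q → Q ⊆ P → ∀ S ⊆ Q, S ∪ U ⊆ P := by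
    intro P Q R U hU hR hQ S hS
    exact Finset.union_subset (hS.trans hQ) ((hU.trans hR).trans Finset.sdiff_subset)
  refine ⟨fun S hS T hT hlt => ?_, fun S hS T hT heq => ?_, ?_⟩
  · refine Finset.sum_eq_zero fun U hU => Finset.sum_eq_zero fun V hV => ?_
    rw [Finset.mem_powerset] at hU hV
    refine h.vanish _ (hsub hU hZ hA S hS) _ (hsub hV hW hB T hT) ?_
    rw [hcard hU hZ S hS, hcard hV hW T hT]
    omega
  · rw [← h.top S (hS.trans hA) T (hT.trans hB) heq]
    have hz : ∀ U ∈ Z.powerset, ∀ V ∈ W.powerset, ¬ (U = ∅ ∧ V = ∅) → c (S ∪ U) (T ∪ V) = 0 := by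
      intro U hU V hV hne
      rw [Finset.mem_powerset] at hU hV
      refine h.vanish _ (hsub hU hZ hA S hS) _ (hsub hV hW hB T hT) ?_
      rw [hcard hU hZ S hS, hcard hV hW T hT]
      rw [← Finset.card_eq_zero, ← Finset.card_eq_zero] at hne
      omega
    unfold BoolApprox.specialize
    rw [Finset.sum_eq_single ∅, Finset.sum_eq_single ∅]
    · simp
    · intro V hV hne
      exact hz ∅ (by simp) V hV (by simp [hne])
    · simp
    · intro U hU hne
      exact Finset.sum_eq_zero fun V hV => hz U hU V hV (by simp [hne])
    · simp
  · obtain ⟨g', hg'⟩ := h.symm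
    refine ⟨fun a b => ∑ U ∈ Z.powerset, ∑ V ∈ W.powerset,
      if a + U.card + (b + V.card) = j then g (a + U.card) (b + V.card)
      else g' (a + U.card) (b + V.card), fun S hS T hT hj => ?_⟩
    refine Finset.sum_congr rfl fun U hU => Finset.sum_congr rfl fun V hV => ?_
    rw [Finset.mem_powerset] at hU hV
    have hcU := hcard hU hZ S hS
    have hcV := hcard hV hW T hT
    -- Total size `j` is the least possible and forces `U = V = ∅`, where `g` applies; every other
    -- term has size at least `j + 1`, where the inherited symmetry `g'` applies.
    split_ifs with hif
    · have hU0 : U = ∅ := Finset.card_eq_zero.1 (by omega)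
      have hV0 : V = ∅ := Finset.card_eq_zero.1 (by omega)
      subst hU0 hV0
      simpa using hg S hS T hT (by simpa using hif)
    · rw [← hcU, ← hcV]
      exact hg' _ (hsub hU hZ hA S hS) _ (hsub hV hW hB T hT) (by omega)

/-- Asymptotically, a polynomial with admissible coefficients vanishes on at most `5/8` of the
points. -/
def ZeroBound (d j : ℕ) : Prop :=
  ∀ ε > (0 : ℝ), ∃ N : ℕ, ∀ (α : Type) [LinearOrder α] (A B : Finset α)
    (c : Finset α → Finset α → ZMod 2), N ≤ A.card → N ≤ B.card → Admissible d j A B c →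
      ∑ X ∈ A.powerset, ∑ Y ∈ B.powerset, (if bieval c X Y = 0 then (1 : ℝ) else 0)
        ≤ (5 / 8 + ε) * 2 ^ (A.card + B.card)

/-- The bound holds on each subcube obtained by fixing the variables outside `A'` and `B'`, so
averaging over the subcubes gives it on the whole cube with the same `ε`. -/
theorem ZeroBound.succ {d j : ℕ} (h : ZeroBound d j) : ZeroBound d (j + 1) := by
  intro ε hε
  obtain ⟨m, hm⟩ := h ε hε
  obtain ⟨N, hN⟩ := exists_subsets_color_eq_card (j + 1) m
  refine ⟨N, fun α _ A B c hA hB hc => ?_⟩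
  obtain ⟨A', hA', B', hB', hAm, hBm, g, hg⟩ := hN α A B c hA hB
  have key : ∀ Z ∈ (A \ A').powerset, ∀ W ∈ (B \ B').powerset,
      ∑ X ∈ A'.powerset, ∑ Y ∈ B'.powerset,
        (if bieval c (X ∪ Z) (Y ∪ W) = 0 then (1 : ℝ) else 0)
        ≤ (5 / 8 + ε) * 2 ^ (A'.card + B'.card) := by
    intro Z hZ W hW
    rw [Finset.mem_powerset] at hZ hW
    refine le_trans (le_of_eq ?_) (hm α A' B' (BoolApprox.specialize c Z W) hAm.ge hBm.ge
      (hc.specialize hA' hB' (fun S hS T hT hST => hg S hS T hT (by omega) (by omega)) hZ hW))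
    refine Finset.sum_congr rfl fun X hX => Finset.sum_congr rfl fun Y hY => ?_
    rw [Finset.mem_powerset] at hX hY
    rw [bieval_union c (Finset.disjoint_sdiff.mono hX hZ) (Finset.disjoint_sdiff.mono hY hW)]
  have hAu : A' ∪ A \ A' = A := Finset.union_sdiff_of_subset hA'
  have hBu : B' ∪ B \ B' = B := Finset.union_sdiff_of_subset hB'
  have hAc := Finset.card_sdiff_add_card_eq_card hA'
  have hBc := Finset.card_sdiff_add_card_eq_card hB'
  have split : ∑ X ∈ A.powerset, ∑ Y ∈ B.powerset, (if bieval c X Y = 0 then (1 : ℝ) else 0)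
      = ∑ Z ∈ (A \ A').powerset, ∑ W ∈ (B \ B').powerset,
        ∑ X ∈ A'.powerset, ∑ Y ∈ B'.powerset,
        (if bieval c (X ∪ Z) (Y ∪ W) = 0 then (1 : ℝ) else 0) := by
    conv_lhs => rw [← hAu, ← hBu]
    rw [sum_powerset_union Finset.disjoint_sdiff, Finset.sum_comm]
    refine Finset.sum_congr rfl fun Z _ => ?_
    symm
    rw [Finset.sum_comm]
    refine Finset.sum_congr rfl fun X _ => ?_
    rw [sum_powerset_union Finset.disjoint_sdiff, Finset.sum_comm]
  rw [split]
  refine (Finset.sum_le_sum fun Z hZ => Finset.sum_le_sum fun W hW => key Z hZ W hW).trans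
    (le_of_eq ?_)
  simp only [Finset.sum_const, Finset.card_powerset, nsmul_eq_mul]
  rw [← hAc, ← hBc]
  push_cast
  ring

theorem ZeroBound.of_zero {d : ℕ} (h : ZeroBound d 0) (j : ℕ) : ZeroBound d j := by
  induction j with
  | zero => exact h
  | succ j ih => exact ih.succ

/-! ### Equidistribution of subset sizes modulo `m`. -/

theorem norm_one_add_lt_two {z : ℂ} (hz : ‖z‖ = 1) (h1 : z ≠ 1) : ‖1 + z‖ < 2 := by
  have := norm_add_lt_of_not_sameRay (x := (1 : ℂ)) (y := z) (fun h => h1 ?_)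
  · rw [norm_one, hz] at this
    linarith
  · exact ((sameRay_iff_of_norm_eq (by simp [hz])).1 h).symm

/-- The number of subsets of an `n`-element set whose size is `r` modulo `m`. -/
def residueCount (m r n : ℕ) : ℕ :=
  ((Finset.range n).powerset.filter fun X => X.card % m = r).card

theorem card_filter_powerset_card_mod {α : Type} (A : Finset α) (m r : ℕ) :
    (A.powerset.filter fun X => X.card % m = r).card = residueCount m r A.card := by
  unfold residueCount
  have key : ∀ {β : Type} (B : Finset β), (B.powerset.filter fun X => X.card % m = r).card
      = ∑ k ∈ Finset.range (B.card + 1), B.card.choose k * if k % m = r then 1 else 0 := by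
    intro β B
    rw [Finset.card_filter, Finset.sum_powerset_apply_card (fun k => if k % m = r then 1 else 0)]
    simp
  rw [key, key, Finset.card_range]

/-- Roots of unity filter: the frequency is an average of terms `((1 + ω^j)/2)^n`, which decay
except for `j = 0`. -/
theorem tendsto_residueCount {m r : ℕ} (hr : r < m) :
    Tendsto (fun n => (residueCount m r n : ℝ) / 2 ^ n) atTop (𝓝 (1 / m)) := by
  have hm : m ≠ 0 := by omega
  set ω : ℂ := Complex.exp (2 * Real.pi * Complex.I / m)
  have hprim : IsPrimitiveRoot ω m := Complex.isPrimitiveRoot_exp m hm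
  have hnorm : ‖ω‖ = 1 := hprim.norm'_eq_one hm
  -- The exponent `k + (m - r)` stands for `k - r`, which is the same modulo `m`.
  have orth : ∀ k : ℕ, ∑ j ∈ Finset.range m, (ω ^ j) ^ (k + (m - r)) =
      if k % m = r then (m : ℂ) else 0 := by
    intro k
    rw [Finset.sum_congr rfl fun j _ => pow_right_comm ω j (k + (m - r))]
    have hiff : ω ^ (k + (m - r)) = 1 ↔ k % m = r := by
      rw [hprim.pow_eq_one_iff_dvd, Nat.dvd_iff_mod_eq_zero, Nat.add_mod]
      rcases Nat.eq_zero_or_pos r with h0 | h0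
      · subst h0; simp
      · rw [Nat.mod_eq_of_lt (show m - r < m by omega)]
        have := Nat.mod_lt k (Nat.pos_of_ne_zero hm)
        constructor
        · intro h
          have := Nat.dvd_of_mod_eq_zero h
          obtain ⟨q, hq⟩ := this
          have : q < 2 := by
            by_contra hc
            have : m * 2 ≤ m * q := Nat.mul_le_mul_left _ (by omega)
            omega
          interval_cases q <;> omega
        · intro h
          rw [h, Nat.add_sub_cancel' hr.le, Nat.mod_self]
    split_ifs with h
    · rw [hiff.2 h]; simp
    · have hne : ω ^ (k + (m - r)) ≠ 1 := fun h' => h (hiff.1 h')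
      rw [geom_sum_eq hne, ← pow_mul, mul_comm, pow_mul, hprim.pow_eq_one]; simp
  have formula : ∀ n : ℕ, ((residueCount m r n : ℝ) / 2 ^ n : ℂ) =
      ∑ j ∈ Finset.range m, (ω ^ j) ^ (m - r) / m * ((1 + ω ^ j) / 2) ^ n := by
    intro n
    have h1 : (residueCount m r n : ℂ) * m =
        ∑ j ∈ Finset.range m, (ω ^ j) ^ (m - r) * (1 + ω ^ j) ^ n := by
      have : ∀ j : ℕ, (1 + ω ^ j) ^ n = ∑ X ∈ (Finset.range n).powerset, (ω ^ j) ^ X.card := by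
        intro j
        have := Finset.sum_pow_mul_eq_add_pow (ω ^ j) 1 (Finset.range n)
        simp only [one_pow, mul_one, Finset.card_range] at this
        rw [this, add_comm]
      simp_rw [this, Finset.mul_sum]
      rw [Finset.sum_comm]
      have : ∀ X ∈ (Finset.range n).powerset,
          ∑ j ∈ Finset.range m, (ω ^ j) ^ (m - r) * (ω ^ j) ^ X.card
            = if X.card % m = r then (m : ℂ) else 0 := by
        intro X _
        rw [← orth]
        exact Finset.sum_congr rfl fun j _ => by rw [← pow_add, add_comm]
      rw [Finset.sum_congr rfl this, ← Finset.sum_filter, Finset.sum_const, nsmul_eq_mul]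
      rfl
    have hmC : (m : ℂ) ≠ 0 := by exact_mod_cast hm
    have h2 : (residueCount m r n : ℂ) = (∑ j ∈ Finset.range m, (ω ^ j) ^ (m - r) *
        (1 + ω ^ j) ^ n) / m := by
      rw [← h1]; field_simp
    push_cast
    rw [h2, Finset.sum_div, Finset.sum_div]
    refine Finset.sum_congr rfl fun j _ => ?_
    rw [div_pow]
    field_simp
  have lim : Tendsto (fun n : ℕ => ∑ j ∈ Finset.range m,
      (ω ^ j) ^ (m - r) / m * ((1 + ω ^ j) / 2) ^ n) atTop
      (𝓝 (∑ j ∈ Finset.range m, if j = 0 then 1 / (m : ℂ) else 0)) := by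
    refine tendsto_finsetSum _ fun j hj => ?_
    split_ifs with h
    · subst h
      norm_num
    · have hne : ω ^ j ≠ 1 := hprim.pow_ne_one_of_pos_of_lt h (Finset.mem_range.1 hj)
      have hlt : ‖(1 + ω ^ j) / 2‖ < 1 := by
        rw [norm_div, Complex.norm_ofNat, div_lt_one (by norm_num)]
        exact norm_one_add_lt_two (by simp [hnorm]) hne
      simpa using (tendsto_pow_atTop_nhds_zero_of_norm_lt_one hlt).const_mul
        ((ω ^ j) ^ (m - r) / m)
  rw [Finset.sum_ite_eq' (Finset.range m) 0, if_pos (Finset.mem_range.2 (by omega))] at lim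
  simp_rw [← formula] at lim
  have := (Complex.continuous_re.tendsto _).comp lim
  convert this using 2
  · simp only [Function.comp]
    norm_cast
  · rw [← Complex.ofReal_natCast, ← Complex.ofReal_one, ← Complex.ofReal_div, Complex.ofReal_re]

/-- Uniform equidistribution of the pair of sizes modulo `m`. -/
theorem exists_equidistribution {m : ℕ} (hm : 0 < m) {ε : ℝ} (hε : 0 < ε) : ∃ N : ℕ,
    ∀ (α : Type) (A B : Finset α) (R : ℕ → ℕ → Prop) [∀ a b, Decidable (R a b)],
      N ≤ A.card → N ≤ B.card →
      (∀ a b, R a b ↔ R (a % m) (b % m)) →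
      ∑ X ∈ A.powerset, ∑ Y ∈ B.powerset, (if R X.card Y.card then (1 : ℝ) else 0) ≤
        ((∑ a ∈ Finset.range m, ∑ b ∈ Finset.range m, if R a b then (1 : ℝ) else 0) / m ^ 2 + ε) *
          2 ^ (A.card + B.card) := by
  have hm' : (0 : ℝ) < m := by exact_mod_cast hm
  -- `(1/m + δ)^2` exceeds `1/m^2` by `2δ/m + δ^2`, and there are at most `m^2` pairs of residues.
  obtain ⟨δ, hδ, hδ'⟩ : ∃ δ > (0 : ℝ), (m : ℝ) ^ 2 * (2 * δ / m + δ ^ 2) ≤ ε := by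
    have : Tendsto (fun δ : ℝ => (m : ℝ) ^ 2 * (2 * δ / m + δ ^ 2)) (𝓝[>] 0) (𝓝 0) := by
      have : Continuous fun δ : ℝ => (m : ℝ) ^ 2 * (2 * δ / m + δ ^ 2) := by fun_prop
      simpa using (this.tendsto 0).mono_left nhdsWithin_le_nhds
    obtain ⟨δ, h1, h2⟩ := ((this.eventually (ge_mem_nhds hε)).and self_mem_nhdsWithin).exists
    exact ⟨δ, h2, h1⟩
  have hN : ∀ᶠ n in atTop, ∀ r ∈ Finset.range m,
      (residueCount m r n : ℝ) / 2 ^ n ≤ 1 / m + δ := by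
    rw [Finset.eventually_all]
    intro r hr
    exact (tendsto_residueCount (Finset.mem_range.1 hr)).eventually
      (ge_mem_nhds (by linarith))
  obtain ⟨N, hN⟩ := eventually_atTop.1 hN
  refine ⟨N, fun α A B R _ hA hB hR => ?_⟩
  have fiber : ∀ (C : Finset α) (f : ℕ → ℝ), ∑ X ∈ C.powerset, f (X.card % m) =
      ∑ a ∈ Finset.range m, residueCount m a C.card * f a := by
    intro C f
    rw [← Finset.sum_fiberwise_of_maps_to (t := Finset.range m) (g := fun X => X.card % m)
      (fun X _ => Finset.mem_range.2 (Nat.mod_lt _ hm))]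
    refine Finset.sum_congr rfl fun a _ => ?_
    rw [← card_filter_powerset_card_mod, ← nsmul_eq_mul, ← Finset.sum_const]
    refine Finset.sum_congr rfl fun X hX => ?_
    rw [(Finset.mem_filter.1 hX).2]
  have e : ∑ X ∈ A.powerset, ∑ Y ∈ B.powerset, (if R X.card Y.card then (1 : ℝ) else 0) =
      ∑ a ∈ Finset.range m, ∑ b ∈ Finset.range m,
        (residueCount m a A.card : ℝ) * residueCount m b B.card * if R a b then (1 : ℝ) else 0 := by
    have h1 : ∀ X Y : Finset α, (if R X.card Y.card then (1 : ℝ) else 0) =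
        if R (X.card % m) (Y.card % m) then 1 else 0 := fun X Y => by simp only [← hR]
    simp_rw [h1]
    have h2 : ∀ X : Finset α, ∑ Y ∈ B.powerset, (if R (X.card % m) (Y.card % m) then (1 : ℝ) else 0)
        = ∑ b ∈ Finset.range m, residueCount m b B.card * if R (X.card % m) b then (1 : ℝ) else 0 :=
      fun X => fiber B (fun b => if R (X.card % m) b then (1 : ℝ) else 0)
    simp_rw [h2]
    rw [fiber A (fun a => ∑ b ∈ Finset.range m,
      residueCount m b B.card * if R a b then (1 : ℝ) else 0)]
    simp_rw [Finset.mul_sum, mul_assoc]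
  rw [e]
  have bound : ∀ a ∈ Finset.range m, ∀ b ∈ Finset.range m,
      (residueCount m a A.card : ℝ) * residueCount m b B.card * (if R a b then (1 : ℝ) else 0) ≤
        ((if R a b then (1 : ℝ) else 0) / m ^ 2 + (2 * δ / m + δ ^ 2)) *
          2 ^ (A.card + B.card) := by
    intro a ha b hb
    have h1 := (div_le_iff₀ (by positivity)).1 (hN _ hA a ha)
    have h2 := (div_le_iff₀ (by positivity)).1 (hN _ hB b hb)
    split_ifs
    · calc (residueCount m a A.card : ℝ) * residueCount m b B.card * 1
          ≤ ((1 / m + δ) * 2 ^ A.card) * ((1 / m + δ) * 2 ^ B.card) * 1 := by gcongr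
        _ = _ := by rw [pow_add]; field_simp; ring
    · rw [mul_zero, zero_div, zero_add]; positivity
  refine (Finset.sum_le_sum fun a ha => Finset.sum_le_sum fun b hb => bound a ha b hb).trans ?_
  simp_rw [← Finset.sum_mul, Finset.sum_add_distrib, ← Finset.sum_div]
  gcongr
  simp only [Finset.sum_const, Finset.card_range, nsmul_eq_mul]
  refine le_trans (le_of_eq ?_) hδ'
  ring

/-! ### Lucas' theorem and the zeros of symmetric polynomials. -/

theorem sum_range_mul {M : Type*} [AddCommMonoid M] (d n : ℕ) (f : ℕ → M) :
    ∑ a ∈ Finset.range (d * n), f a =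
      ∑ i ∈ Finset.range n, ∑ r ∈ Finset.range d, f (r + d * i) := by
  induction n with
  | zero => simp
  | succ n ih =>
    rw [Nat.mul_succ, Finset.sum_range_add, ih, Finset.sum_range_succ]
    simp only [add_comm]

/-- Lucas' theorem modulo 2, iterated over the lowest `l` binary digits. -/
theorem choose_add_two_pow_mul (l : ℕ) : ∀ {x a : ℕ} (i j : ℕ), x < 2 ^ l → a < 2 ^ l →
    ((x + 2 ^ l * i).choose (a + 2 ^ l * j) : ZMod 2) = x.choose a * i.choose j := by
  have lucas : ∀ n k : ℕ, (n.choose k : ZMod 2) =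
      (n % 2).choose (k % 2) * (n / 2).choose (k / 2) := by
    intro n k
    exact_mod_cast (ZMod.natCast_eq_natCast_iff _ _ _).2
      (Choose.choose_modEq_choose_mod_mul_choose_div_nat (p := 2) (n := n) (k := k))
  induction l with
  | zero =>
    intro x a i j hx ha
    obtain rfl : x = 0 := by omega
    obtain rfl : a = 0 := by omega
    simp
  | succ l ih =>
    intro x a i j hx ha
    rw [pow_succ] at hx ha
    have e1 : ∀ x i : ℕ, (x + 2 ^ (l + 1) * i) % 2 = x % 2 := fun x i => by
      rw [pow_succ, mul_comm _ 2, mul_assoc, Nat.add_mul_mod_self_left]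
    have e2 : ∀ x i : ℕ, (x + 2 ^ (l + 1) * i) / 2 = x / 2 + 2 ^ l * i := fun x i => by
      rw [pow_succ, mul_comm _ 2, mul_assoc, Nat.add_mul_div_left _ _ (by norm_num)]
    rw [lucas, e1, e1, e2, e2, ih i j (by omega) (by omega), lucas x a, mul_assoc]

theorem choose_mod_two_pow {l a : ℕ} (x : ℕ) (ha : a < 2 ^ l) :
    ((x % 2 ^ l).choose a : ZMod 2) = x.choose a := by
  have := choose_add_two_pow_mul l (x / 2 ^ l) 0 (Nat.mod_lt x (by positivity)) ha
  rw [Nat.mod_add_div] at this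
  simpa using this.symm

theorem choose_two_pow (l x : ℕ) : (x.choose (2 ^ l) : ZMod 2) = (x / 2 ^ l : ℕ) := by
  have := choose_add_two_pow_mul l (x / 2 ^ l) 1 (Nat.mod_lt x (by positivity))
    (show 0 < 2 ^ l by positivity)
  rw [Nat.mod_add_div] at this
  simpa using this

/-- The value, at sizes `x` and `y`, of the polynomial `∑ g a b * e_a * e_b`. -/
def symValue (m : ℕ) (g : ℕ → ℕ → ZMod 2) (x y : ℕ) : ZMod 2 :=
  ∑ a ∈ Finset.range m, ∑ b ∈ Finset.range m, (x.choose a : ZMod 2) * y.choose b * g a b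

theorem symValue_mod (l : ℕ) (g : ℕ → ℕ → ZMod 2) (x y : ℕ) :
    symValue (2 ^ l) g (x % 2 ^ l) (y % 2 ^ l) = symValue (2 ^ l) g x y := by
  refine Finset.sum_congr rfl fun a ha => Finset.sum_congr rfl fun b hb => ?_
  rw [choose_mod_two_pow x (Finset.mem_range.1 ha), choose_mod_two_pow y (Finset.mem_range.1 hb)]

/-- With the residues `x`, `y` modulo `2^l` fixed, a symmetric polynomial becomes one in the
quotients `i`, `k`, with coefficients that depend on the residues. -/
theorem symValue_add_mul (l n : ℕ) (g : ℕ → ℕ → ZMod 2) {x y : ℕ} (i k : ℕ) (hx : x < 2 ^ l)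
    (hy : y < 2 ^ l) :
    symValue (2 ^ l * n) g (x + 2 ^ l * i) (y + 2 ^ l * k) =
      symValue n (fun a b => symValue (2 ^ l) (fun r s => g (r + 2 ^ l * a) (s + 2 ^ l * b)) x y)
        i k := by
  unfold symValue
  rw [sum_range_mul]
  refine Finset.sum_congr rfl fun a _ => ?_
  simp_rw [sum_range_mul]
  rw [Finset.sum_comm]
  refine Finset.sum_congr rfl fun b _ => ?_
  rw [Finset.mul_sum]
  refine Finset.sum_congr rfl fun r hr => ?_
  rw [Finset.mul_sum]
  refine Finset.sum_congr rfl fun s hs => ?_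
  rw [choose_add_two_pow_mul l i a hx (Finset.mem_range.1 hr),
    choose_add_two_pow_mul l k b hy (Finset.mem_range.1 hs)]
  ring

/-- The six parameters run over all lower-order terms. The ratio `10/16` is the source of `5/8`. -/
theorem card_zeros_cubic_le : ∀ p q r s t u : ZMod 2,
    (∑ i ∈ Finset.range 4, ∑ k ∈ Finset.range 4,
      if p + q * i + r * k + s * i * k + t * i.choose 2 + u * k.choose 2 +
        i * k.choose 2 + i.choose 2 * k = 0 then 1 else 0) ≤ 10 := by
  decide

theorem card_zeros_symValue_four_le {h : ℕ → ℕ → ZMod 2}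
    (h0 : ∀ a b, 3 < a + b → h a b = 0)
    (h3 : ∀ a b, a + b = 3 → h a b = if a = 1 ∨ a = 2 then 1 else 0) :
    ∑ i ∈ Finset.range 4, ∑ k ∈ Finset.range 4, (if symValue 4 h i k = 0 then (1 : ℝ) else 0)
      ≤ 10 := by
  have e : ∀ i k : ℕ, symValue 4 h i k = h 0 0 + h 1 0 * i + h 0 1 * k + h 1 1 * i * k +
      h 2 0 * i.choose 2 + h 0 2 * k.choose 2 + i * k.choose 2 + i.choose 2 * k := by
    intro i k
    simp only [symValue, Finset.sum_range_succ, Finset.sum_range_zero, zero_add, Nat.choose_zero_right,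
      Nat.choose_one_right, h0 1 3 (by norm_num), h0 2 2 (by norm_num), h0 2 3 (by norm_num),
      h0 3 1 (by norm_num), h0 3 2 (by norm_num), h0 3 3 (by norm_num), h3 0 3 rfl, h3 1 2 rfl,
      h3 2 1 rfl, h3 3 0 rfl]
    norm_num
    ring
  simp_rw [e]
  have := card_zeros_cubic_le (h 0 0) (h 1 0) (h 0 1) (h 1 1) (h 2 0) (h 0 2)
  exact_mod_cast this

theorem card_zeros_symValue_le {l : ℕ} {g : ℕ → ℕ → ZMod 2}
    (h0 : ∀ a b, 3 * 2 ^ l < a + b → g a b = 0)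
    (h3 : ∀ a b, a + b = 3 * 2 ^ l → g a b = if a = 2 ^ l ∨ a = 2 * 2 ^ l then 1 else 0) :
    ∑ x ∈ Finset.range (2 ^ l * 4), ∑ y ∈ Finset.range (2 ^ l * 4),
      (if symValue (2 ^ l * 4) g x y = 0 then (1 : ℝ) else 0) ≤ 10 * (2 ^ l) ^ 2 := by
  have hpos : 0 < 2 ^ l := by positivity
  have key : ∀ r ∈ Finset.range (2 ^ l), ∀ s ∈ Finset.range (2 ^ l),
      ∑ i ∈ Finset.range 4, ∑ k ∈ Finset.range 4,
        (if symValue (2 ^ l * 4) g (r + 2 ^ l * i) (s + 2 ^ l * k) = 0 then (1 : ℝ) else 0)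
        ≤ 10 := by
    intro r hr s hs
    simp_rw [symValue_add_mul l 4 g _ _ (Finset.mem_range.1 hr) (Finset.mem_range.1 hs)]
    apply card_zeros_symValue_four_le
    · intro a b hab
      refine Finset.sum_eq_zero fun u _ => Finset.sum_eq_zero fun v _ => ?_
      refine mul_eq_zero_of_right _ (h0 _ _ ?_)
      have : 2 ^ l * 4 ≤ 2 ^ l * (a + b) := Nat.mul_le_mul_left _ hab
      rw [mul_add] at this
      omega
    · intro a b hab
      have hsum : 2 ^ l * a + 2 ^ l * b = 3 * 2 ^ l := by rw [← mul_add, hab, mul_comm]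
      -- Any nonzero residue `u` or `v` pushes the degree past `3 * 2 ^ l`, so the cubic part does
      -- not depend on the fixed residues.
      have hz : ∀ u v : ℕ, ¬ (u = 0 ∧ v = 0) → g (u + 2 ^ l * a) (v + 2 ^ l * b) = 0 :=
        fun u v huv => h0 _ _ (by omega)
      unfold symValue
      rw [Finset.sum_eq_single 0, Finset.sum_eq_single 0]
      · simp only [zero_add, Nat.choose_zero_right, Nat.cast_one, one_mul]
        rw [h3 _ _ hsum]
        have i1 : 2 ^ l * a = 2 ^ l ↔ a = 1 := by
          constructor
          · intro h; exact Nat.eq_of_mul_eq_mul_left hpos (by omega)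
          · rintro rfl; simp
        have i2 : 2 ^ l * a = 2 * 2 ^ l ↔ a = 2 := by
          constructor
          · intro h; exact Nat.eq_of_mul_eq_mul_left hpos (by omega)
          · rintro rfl; ring
        simp only [i1, i2]
      · intro v _ hv
        exact mul_eq_zero_of_right _ (hz _ _ (by omega))
      · intro h; exact absurd (Finset.mem_range.2 hpos) h
      · intro u _ hu
        exact Finset.sum_eq_zero fun v _ => mul_eq_zero_of_right _ (hz _ _ (by omega))
      · intro h; exact absurd (Finset.mem_range.2 hpos) h
  have re : ∑ x ∈ Finset.range (2 ^ l * 4), ∑ y ∈ Finset.range (2 ^ l * 4),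
      (if symValue (2 ^ l * 4) g x y = 0 then (1 : ℝ) else 0) =
      ∑ r ∈ Finset.range (2 ^ l), ∑ s ∈ Finset.range (2 ^ l),
      ∑ i ∈ Finset.range 4, ∑ k ∈ Finset.range 4,
        (if symValue (2 ^ l * 4) g (r + 2 ^ l * i) (s + 2 ^ l * k) = 0 then (1 : ℝ) else 0) := by
    simp_rw [sum_range_mul (2 ^ l) 4]
    rw [Finset.sum_comm]
    refine Finset.sum_congr rfl fun r _ => ?_
    symm
    rw [Finset.sum_comm]
    refine Finset.sum_congr rfl fun i _ => ?_
    rw [Finset.sum_comm]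
  rw [re]
  refine (Finset.sum_le_sum fun r hr => Finset.sum_le_sum fun s hs => key r hr s hs).trans
    (le_of_eq ?_)
  simp only [Finset.sum_const, Finset.card_range, nsmul_eq_mul]
  push_cast
  ring

theorem sum_powerset_card {α R : Type*} [CommSemiring R] (X : Finset α) {m : ℕ} {f : ℕ → R}
    (hf : ∀ a, m ≤ a → f a = 0) :
    ∑ S ∈ X.powerset, f S.card = ∑ a ∈ Finset.range m, (X.card.choose a : R) * f a := by
  rw [Finset.sum_powerset_apply_card]
  simp_rw [nsmul_eq_mul]
  have h1 : Finset.range (X.card + 1) ⊆ Finset.range (max (X.card + 1) m) :=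
    Finset.range_subset_range.2 (le_max_left _ _)
  have h2 : Finset.range m ⊆ Finset.range (max (X.card + 1) m) :=
    Finset.range_subset_range.2 (le_max_right _ _)
  rw [Finset.sum_subset h1, Finset.sum_subset h2]
  · intro a _ ha
    rw [hf a (by simpa using ha), mul_zero]
  · intro a _ ha
    rw [Nat.choose_eq_zero_of_lt (by simpa using ha), Nat.cast_zero, zero_mul]

theorem bieval_eq_symValue {α : Type*} {m : ℕ} {g : ℕ → ℕ → ZMod 2} {X Y : Finset α}
    {c : Finset α → Finset α → ZMod 2} (hc : ∀ S ⊆ X, ∀ T ⊆ Y, c S T = g S.card T.card)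
    (hg : ∀ a b, m ≤ a + b → g a b = 0) : bieval c X Y = symValue m g X.card Y.card := by
  have h1 : bieval c X Y = ∑ S ∈ X.powerset, ∑ b ∈ Finset.range m,
      (Y.card.choose b : ZMod 2) * g S.card b := by
    refine Finset.sum_congr rfl fun S hS => ?_
    rw [← sum_powerset_card Y (fun b hb => hg S.card b (by omega))]
    exact Finset.sum_congr rfl fun T hT =>
      hc S (Finset.mem_powerset.1 hS) T (Finset.mem_powerset.1 hT)
  rw [h1, sum_powerset_card X (m := m)
    (f := fun a => ∑ b ∈ Finset.range m, (Y.card.choose b : ZMod 2) * g a b)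
    (fun a ha => Finset.sum_eq_zero fun b _ => by rw [hg a b (by omega), mul_zero])]
  simp_rw [symValue, Finset.mul_sum, mul_assoc]

theorem zeroBound_zero (l : ℕ) : ZeroBound (2 ^ l) 0 := by
  intro ε hε
  have hpos : 0 < 2 ^ l := by positivity
  obtain ⟨N, hN⟩ := exists_equidistribution (m := 2 ^ l * 4) (by positivity) hε
  refine ⟨N, fun α _ A B c hA hB hc => ?_⟩
  obtain ⟨g, hg⟩ := hc.symm
  -- `g` is determined only at sizes occurring in `A` and `B`; prescribing the values in degrees at
  -- least `3 * 2 ^ l` makes the degree conditions hold at all pairs.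
  set g' : ℕ → ℕ → ZMod 2 := fun a b =>
    if 3 * 2 ^ l < a + b then 0 else if a + b = 3 * 2 ^ l then
      if a = 2 ^ l ∨ a = 2 * 2 ^ l then 1 else 0 else g a b with hg'
  have hcg : ∀ S ⊆ A, ∀ T ⊆ B, c S T = g' S.card T.card := by
    intro S hS T hT
    simp only [hg']
    split_ifs with h1 h2 h3
    · exact hc.vanish S hS T hT h1
    · rw [hc.top S hS T hT h2, if_pos h3]
    · rw [hc.top S hS T hT h2, if_neg h3]
    · exact hg S hS T hT (Nat.zero_le _)
  have h0 : ∀ a b, 3 * 2 ^ l < a + b → g' a b = 0 := fun a b h => if_pos h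
  have h3 : ∀ a b, a + b = 3 * 2 ^ l → g' a b = if a = 2 ^ l ∨ a = 2 * 2 ^ l then 1 else 0 :=
    fun a b h => by simp only [hg', h, lt_irrefl, if_false, if_true]
  have e : ∑ X ∈ A.powerset, ∑ Y ∈ B.powerset, (if bieval c X Y = 0 then (1 : ℝ) else 0) =
      ∑ X ∈ A.powerset, ∑ Y ∈ B.powerset,
        (if symValue (2 ^ l * 4) g' X.card Y.card = 0 then (1 : ℝ) else 0) := by
    refine Finset.sum_congr rfl fun X hX => Finset.sum_congr rfl fun Y hY => ?_
    rw [Finset.mem_powerset] at hX hY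
    rw [bieval_eq_symValue (m := 2 ^ l * 4) (fun S hS T hT => hcg S (hS.trans hX) T (hT.trans hY))
      (fun a b hab => h0 a b (by omega))]
  rw [e]
  refine (hN α A B (fun a b => symValue (2 ^ l * 4) g' a b = 0) hA hB ?_).trans ?_
  · intro a b
    have := symValue_mod (l + 2) g' a b
    rw [pow_add] at this
    norm_num at this
    rw [this]
  · refine mul_le_mul_of_nonneg_right (add_le_add_left ?_ ε) (by positivity)
    rw [div_le_iff₀ (by positivity)]
    refine (card_zeros_symValue_le h0 h3).trans (le_of_eq ?_)
    push_cast
    ring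

/-! ### The congruence modulo 4 behind the lower bound. -/

/-- With `d = 2^l`, compare the two sides of `C(x,d) C(x-d,d) = C(x,2d) C(2d,d)`. Here `C(2d,d)` is
twice an odd number, and `C(x-d,d)` is odd because subtracting `d` flips bit `l` of `x`. -/
theorem choose_two_pow_eq_two_mul_choose {l x : ℕ} (h : (x.choose (2 ^ l) : ZMod 2) = 0) :
    (x.choose (2 ^ l) : ZMod 4) = 2 * x.choose (2 * 2 ^ l) := by
  have hpos : 0 < 2 ^ l := by positivity
  rcases lt_or_ge x (2 ^ l) with hx | hx
  · rw [Nat.choose_eq_zero_of_lt hx, Nat.choose_eq_zero_of_lt (by omega)]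
    simp
  have heven : 2 ∣ x.choose (2 ^ l) := (ZMod.natCast_eq_zero_iff _ _).1 h
  have hodd₁ : (x - 2 ^ l).choose (2 ^ l) % 2 = 1 := by
    have h1 := choose_two_pow l (x - 2 ^ l)
    have h2 := choose_two_pow l x
    rw [h] at h2
    have h3 : 2 ∣ x / 2 ^ l := (ZMod.natCast_eq_zero_iff _ _).1 h2.symm
    have h4 := (ZMod.natCast_eq_natCast_iff _ _ _).1 h1
    have h5 : x / 2 ^ l = (x - 2 ^ l) / 2 ^ l + 1 := by
      conv_lhs => rw [← Nat.sub_add_cancel hx, Nat.add_div_right _ hpos]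
    unfold Nat.ModEq at h4
    omega
  obtain ⟨w, hw, hwodd⟩ : ∃ w, (2 * 2 ^ l).choose (2 ^ l) = 2 * w ∧ w % 2 = 1 := by
    refine ⟨(2 * 2 ^ l - 1).choose (2 ^ l), ?_, ?_⟩
    · have h1 := Nat.choose_succ_right_eq (2 * 2 ^ l - 1) (2 ^ l - 1)
      rw [Nat.sub_add_cancel hpos, show 2 * 2 ^ l - 1 - (2 ^ l - 1) = 2 ^ l by omega] at h1
      have h2 := Nat.eq_of_mul_eq_mul_right hpos h1
      obtain ⟨t, ht⟩ : ∃ t, 2 ^ l = t + 1 := ⟨2 ^ l - 1, by omega⟩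
      rw [ht] at h2 ⊢
      rw [show 2 * (t + 1) = (2 * t + 1) + 1 by ring, Nat.choose_succ_succ]
      simp only [show 2 * (t + 1) - 1 = 2 * t + 1 by omega, Nat.add_sub_cancel] at h2 ⊢
      rw [Nat.succ_eq_add_one, h2]
      ring
    · have h1 := (ZMod.natCast_eq_natCast_iff _ _ _).1 (choose_two_pow l (2 * 2 ^ l - 1))
      have h2 : (2 * 2 ^ l - 1) / 2 ^ l = 1 := by
        rw [Nat.div_eq_iff hpos]; omega
      rw [h2] at h1
      exact h1
  have hid : x.choose (2 ^ l) * (x - 2 ^ l).choose (2 ^ l) = x.choose (2 * 2 ^ l) * (2 * w) := by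
    rw [← hw, Nat.choose_mul (by omega)]
    congr 2
    omega
  have : x.choose (2 ^ l) ≡ 2 * x.choose (2 * 2 ^ l) [MOD 4] := by
    obtain ⟨t, ht⟩ := heven
    obtain ⟨u, hu⟩ : ∃ u, (x - 2 ^ l).choose (2 ^ l) = 2 * u + 1 :=
      ⟨(x - 2 ^ l).choose (2 ^ l) / 2, by omega⟩
    obtain ⟨v, hv⟩ : ∃ v, w = 2 * v + 1 := ⟨w / 2, by omega⟩
    rw [ht, hu, hv] at hid
    rw [ht]
    generalize x.choose (2 * 2 ^ l) = z at *
    have e1 : 2 * t * (2 * u + 1) = 4 * (t * u) + 2 * t := by ring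
    have e2 : z * (2 * (2 * v + 1)) = 4 * (z * v) + 2 * z := by ring
    rw [e1, e2] at hid
    unfold Nat.ModEq
    omega
  exact_mod_cast (ZMod.natCast_eq_natCast_iff _ _ _).2 this

theorem exists_both_odd_bound (l : ℕ) {ε : ℝ} (hε : 0 < ε) : ∃ N : ℕ,
    ∀ (α : Type) (A B : Finset α), N ≤ A.card → N ≤ B.card →
      ∑ X ∈ A.powerset, ∑ Y ∈ B.powerset,
        (if (X.card.choose (2 ^ l) : ZMod 2) ≠ 0 ∧ (Y.card.choose (2 ^ l) : ZMod 2) ≠ 0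
          then (1 : ℝ) else 0) ≤ (1 / 4 + ε) * 2 ^ (A.card + B.card) := by
  obtain ⟨N, hN⟩ := exists_equidistribution (m := 2 ^ l * 4) (by positivity) hε
  refine ⟨N, fun α A B hA hB => ?_⟩
  refine (hN α A B (fun a b => (a.choose (2 ^ l) : ZMod 2) ≠ 0 ∧ (b.choose (2 ^ l) : ZMod 2) ≠ 0)
    hA hB ?_).trans (le_of_eq ?_)
  · intro a b
    have hlt : 2 ^ l < 2 ^ (l + 2) := Nat.pow_lt_pow_right (by norm_num) (by omega)
    have e : 2 ^ l * 4 = 2 ^ (l + 2) := by rw [pow_add]; rfl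
    rw [e, choose_mod_two_pow a hlt, choose_mod_two_pow b hlt]
  · congr 2
    have one : ∑ a ∈ Finset.range (2 ^ l * 4),
        (if (a.choose (2 ^ l) : ZMod 2) ≠ 0 then (1 : ℝ) else 0) = 2 * 2 ^ l := by
      rw [sum_range_mul, Finset.sum_comm]
      have : ∀ r ∈ Finset.range (2 ^ l), ∑ i ∈ Finset.range 4,
          (if (((r + 2 ^ l * i).choose (2 ^ l) : ℕ) : ZMod 2) ≠ 0 then (1 : ℝ) else 0) = 2 := by
        intro r hr
        rw [Finset.mem_range] at hr
        have h1 : ∀ i, (((r + 2 ^ l * i).choose (2 ^ l) : ℕ) : ZMod 2) = i := fun i => by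
          rw [choose_two_pow, Nat.add_mul_div_left _ _ (by positivity), Nat.div_eq_of_lt hr,
            zero_add]
        simp_rw [h1]
        have h2 : ∑ i ∈ Finset.range 4, (if (i : ZMod 2) ≠ 0 then 1 else 0) = 2 := by decide
        exact_mod_cast congrArg (Nat.cast (R := ℝ)) h2
      rw [Finset.sum_congr rfl this]
      simp [mul_comm]
    have prod : ∀ a b : ℕ, (if (a.choose (2 ^ l) : ZMod 2) ≠ 0 ∧ (b.choose (2 ^ l) : ZMod 2) ≠ 0
        then (1 : ℝ) else 0) = (if (a.choose (2 ^ l) : ZMod 2) ≠ 0 then (1 : ℝ) else 0) *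
          (if (b.choose (2 ^ l) : ZMod 2) ≠ 0 then (1 : ℝ) else 0) := by
      intro a b
      split_ifs <;> simp_all
    simp_rw [prod, ← Finset.mul_sum, ← Finset.sum_mul, one]
    have : (2 : ℝ) ^ l ≠ 0 := by positivity
    push_cast
    field_simp
    norm_num

/-! ### Transfer to polynomials and functions on the Boolean cube. -/

section Cube

variable {ι : Type} [LinearOrder ι]

theorem sum_cube [Fintype ι] {M : Type*} [AddCommMonoid M] {A B : Finset ι} (hd : Disjoint A B)
    (hu : A ∪ B = Finset.univ) (f : Finset ι → Finset ι → M) :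
    ∑ z : ι → Bool, f (A.filter fun i => z i) (B.filter fun i => z i) =
      ∑ X ∈ A.powerset, ∑ Y ∈ B.powerset, f X Y := by
  have h1 : ∑ z : ι → Bool, f (A.filter fun i => z i) (B.filter fun i => z i) =
      ∑ S ∈ (Finset.univ : Finset ι).powerset, f (A ∩ S) (B ∩ S) := by
    refine Finset.sum_nbij' (fun z => Finset.univ.filter fun i => z i)
      (fun S i => decide (i ∈ S)) ?_ ?_ ?_ ?_ ?_
    · simp
    · simp
    · intro z _; ext i; simp
    · intro S _; ext i; simp
    · intro z _
      congr 1 <;> ext i <;> simp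
  rw [h1, ← hu, sum_powerset_union hd]
  refine Finset.sum_congr rfl fun X hX => Finset.sum_congr rfl fun Y hY => ?_
  rw [Finset.mem_powerset] at hX hY
  congr 1
  · rw [Finset.inter_union_distrib_left, Finset.inter_eq_right.2 hX,
      Finset.disjoint_iff_inter_eq_empty.1 (hd.mono_right hY), Finset.union_empty]
  · rw [Finset.inter_union_distrib_left, Finset.inter_eq_right.2 hY,
      Finset.disjoint_iff_inter_eq_empty.1 (hd.symm.mono_right hX), Finset.empty_union]

theorem agr_eq [Fintype ι] {R : Type*} [DecidableEq R] {A B : Finset ι} (hd : Disjoint A B)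
    (hu : A ∪ B = Finset.univ) (f g : (ι → Bool) → R) :
    agr f g = (∑ z : ι → Bool, if f z = g z then (1 : ℝ) else 0) / 2 ^ (A.card + B.card) := by
  have : Fintype.card ι = A.card + B.card := by
    rw [← Finset.card_union_of_disjoint hd, hu, Finset.card_univ]
  rw [agr, Finset.card_filter, Fintype.card_fun, Fintype.card_bool, this]
  push_cast
  rfl

/-- On 0/1 points a monomial depends only on its support, so coefficients are collected by support.
-/
theorem exists_polyFun_eq_sum [Fintype ι] {R : Type*} [CommSemiring R] (Q : MvPolynomial ι R) :
    ∃ c : Finset ι → R, (∀ T, Q.totalDegree < T.card → c T = 0) ∧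
      ∀ z : ι → Bool, polyFun Q z = ∑ T ∈ (Finset.univ.filter fun i => z i).powerset, c T := by
  refine ⟨fun T => ∑ m ∈ Q.support with m.support = T, Q.coeff m, fun T hT => ?_, fun z => ?_⟩
  · refine Finset.sum_eq_zero fun m hm => ?_
    obtain ⟨hm', rfl⟩ := Finset.mem_filter.1 hm
    exfalso
    have h1 := MvPolynomial.le_totalDegree hm'
    have h2 : m.support.card ≤ m.sum fun _ e => e := by
      rw [Finset.card_eq_sum_ones]
      exact Finset.sum_le_sum fun i hi => Nat.one_le_iff_ne_zero.2 (Finsupp.mem_support_iff.1 hi)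
    omega
  · rw [Finset.sum_fiberwise_eq_sum_filter, polyFun, MvPolynomial.eval_eq, Finset.sum_filter]
    refine Finset.sum_congr rfl fun m _ => ?_
    split_ifs with h
    · rw [Finset.prod_eq_one, mul_one]
      intro i hi
      have := Finset.mem_powerset.1 h hi
      simp at this
      simp [this]
    · obtain ⟨i, hi, hz⟩ := Finset.not_subset.1 (fun h' => h (Finset.mem_powerset.2 h'))
      rw [Finset.prod_eq_zero hi, mul_zero]
      simp at hz
      simp [hz, Finsupp.mem_support_iff.1 hi]

/-- The cubic form `C(x,d) C(y,2d) + C(x,2d) C(y,d)` modulo `2`. -/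
def crossValue (d x y : ℕ) : ZMod 2 :=
  x.choose d * y.choose (2 * d) + x.choose (2 * d) * y.choose d

/-- The Boolean function computed by `e_d(x) e_{2d}(y) + e_{2d}(x) e_d(y)` in two blocks of
variables. -/
def crossFun (d : ℕ) (A B : Finset ι) (z : ι → Bool) : Bool :=
  decide (crossValue d (A.filter fun i => z i).card (B.filter fun i => z i).card = 1)

/-- The coefficients of `e_d(x) e_{2d}(y) + e_{2d}(x) e_d(y) + ∑ c S`. -/
def crossCoeff (d : ℕ) (c : Finset ι → ZMod 2) (S T : Finset ι) : ZMod 2 :=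
  (if S.card = d ∧ T.card = 2 * d ∨ S.card = 2 * d ∧ T.card = d then 1 else 0) + c (S ∪ T)

theorem bieval_crossCoeff {d : ℕ} (hpos : 0 < d) (c : Finset ι → ZMod 2) {X Y : Finset ι}
    (h : Disjoint X Y) :
    bieval (crossCoeff d c) X Y =
      crossValue d X.card Y.card + ∑ T ∈ (X ∪ Y).powerset, c T := by
  unfold bieval crossCoeff
  simp_rw [Finset.sum_add_distrib]
  rw [sum_powerset_union h]
  congr 1
  have split : ∀ s t : ℕ,
      (if s = d ∧ t = 2 * d ∨ s = 2 * d ∧ t = d then (1 : ZMod 2) else 0) =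
      (if s = d then 1 else 0) * (if t = 2 * d then 1 else 0) +
        (if s = 2 * d then 1 else 0) * (if t = d then 1 else 0) := by
    intro s t
    split_ifs <;> first | omega | simp
  have cnt : ∀ (Z : Finset ι) (k : ℕ),
      ∑ S ∈ Z.powerset, (if S.card = k then (1 : ZMod 2) else 0) = Z.card.choose k := by
    intro Z k
    rw [← Finset.sum_filter, Finset.sum_const, nsmul_eq_mul, mul_one,
      ← Finset.powersetCard_eq_filter, Finset.card_powersetCard]
  simp_rw [split, Finset.sum_add_distrib, ← Finset.mul_sum, ← Finset.sum_mul, cnt]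
  rfl

theorem admissible_crossCoeff {d : ℕ} (hpos : 0 < d) {c : Finset ι → ZMod 2} {A B : Finset ι}
    (h : Disjoint A B) (hc : ∀ T, 3 * d - 1 < T.card → c T = 0) :
    Admissible d (3 * d) A B (crossCoeff d c) := by
  have hcard : ∀ S ⊆ A, ∀ T ⊆ B, (S ∪ T).card = S.card + T.card := fun S hS T hT =>
    Finset.card_union_of_disjoint (h.mono hS hT)
  have hval : ∀ S ⊆ A, ∀ T ⊆ B, 3 * d ≤ S.card + T.card → crossCoeff d c S T =
      if S.card = d ∧ T.card = 2 * d ∨ S.card = 2 * d ∧ T.card = d then 1 else 0 := by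
    intro S hS T hT hST
    rw [crossCoeff, hc _ (by rw [hcard S hS T hT]; omega), add_zero]
  refine ⟨fun S hS T hT hST => ?_, fun S hS T hT hST => ?_,
    fun a b => if a = d ∧ b = 2 * d ∨ a = 2 * d ∧ b = d then 1 else 0, hval⟩
  · rw [hval S hS T hT hST.le, if_neg (by omega)]
  · rw [hval S hS T hT hST.ge]
    exact if_congr (by omega) rfl rfl

theorem gamma_one_le (l : ℕ) {ε : ℝ} (hε : 0 < ε) : ∃ N : ℕ,
    ∀ (ι : Type) [Fintype ι] [LinearOrder ι] (A B : Finset ι), Disjoint A B →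
      A ∪ B = Finset.univ → N ≤ A.card → N ≤ B.card →
      gamma (3 * 2 ^ l - 1) 1 (crossFun (2 ^ l) A B) ≤ 5 / 8 + ε := by
  have hpos : 0 < 2 ^ l := by positivity
  obtain ⟨N, hN⟩ := (zeroBound_zero l).of_zero (3 * 2 ^ l) ε hε
  refine ⟨N, fun ι _ _ A B hd hu hA hB => ?_⟩
  obtain ⟨⟨Q, hQ, hQγ⟩, -⟩ := isGreatest_gamma (3 * 2 ^ l - 1) 1 (crossFun (2 ^ l) A B)
  rw [← hQγ]
  obtain ⟨c, hc, hQc⟩ := exists_polyFun_eq_sum Q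
  have hc' : ∀ T, 3 * 2 ^ l - 1 < T.card → c T = 0 := fun T hT => hc T (hQ.2.trans_lt hT)
  change Finset ι → ZMod 2 at c
  have hiff : ∀ z : ι → Bool, lift 1 (crossFun (2 ^ l) A B) z = polyFun Q z ↔
      bieval (crossCoeff (2 ^ l) c) (A.filter fun i => z i) (B.filter fun i => z i) = 0 := by
    intro z
    rw [bieval_crossCoeff hpos c (hd.mono (Finset.filter_subset _ _) (Finset.filter_subset _ _)),
      ← Finset.filter_union, hu, hQc z]
    -- In characteristic 2, agreement with `Q` is vanishing of the sum.
    have two : ∀ u v : ZMod 2, (if u = 1 then (1 : ZMod 2) else 0) = v ↔ u + v = 0 := by decide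
    rw [← two]
    simp [lift, crossFun]
  simp_rw [agr_eq hd hu, hiff]
  rw [sum_cube hd hu fun X Y => if bieval (crossCoeff (2 ^ l) c) X Y = 0 then (1 : ℝ) else 0,
    div_le_iff₀ (by positivity)]
  exact hN ι A B _ hA hB (admissible_crossCoeff hpos hd hc')

/-- The product `e_d(x) e_d(y)` in two blocks of variables. -/
noncomputable def esymmProd (R : Type*) [CommSemiring R] (d : ℕ) (A B : Finset ι) :
    MvPolynomial ι R :=
  ∑ S ∈ A.powersetCard d, ∑ T ∈ B.powersetCard d, ∏ i ∈ S ∪ T, MvPolynomial.X i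

theorem esymmProd_mem (d k : ℕ) (A B : Finset ι) :
    esymmProd (ZMod (2 ^ (k + 1))) d A B ∈ multilinearPolys ι (2 * d) (k + 1) := by
  have : Fact (1 < 2 ^ (k + 1)) := ⟨Nat.one_lt_two_pow (by omega)⟩
  refine ⟨fun i => ?_, ?_⟩
  · refine (MvPolynomial.degreeOf_sum_le _ _ _).trans (Finset.sup_le fun S _ => ?_)
    refine (MvPolynomial.degreeOf_sum_le _ _ _).trans (Finset.sup_le fun T _ => ?_)
    refine (MvPolynomial.degreeOf_prod_le _ _ _).trans ?_
    simp_rw [MvPolynomial.degreeOf_X]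
    rw [Finset.sum_ite_eq]
    split_ifs <;> simp
  · refine MvPolynomial.totalDegree_finsetSum_le fun S hS => ?_
    refine MvPolynomial.totalDegree_finsetSum_le fun T hT => ?_
    refine (MvPolynomial.totalDegree_finsetProd _ _).trans ?_
    simp_rw [MvPolynomial.totalDegree_X]
    rw [Finset.sum_const, smul_eq_mul, mul_one]
    refine (Finset.card_union_le _ _).trans ?_
    rw [(Finset.mem_powersetCard.1 hS).2, (Finset.mem_powersetCard.1 hT).2, two_mul]

theorem polyFun_esymmProd {R : Type*} [CommSemiring R] (d : ℕ) {A B : Finset ι}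
    (hd : Disjoint A B) (z : ι → Bool) :
    polyFun (esymmProd R d A B) z =
      (A.filter fun i => z i).card.choose d * (B.filter fun i => z i).card.choose d := by
  have cnt : ∀ C : Finset ι, ∑ S ∈ C.powersetCard d, ∏ i ∈ S, (if z i then (1 : R) else 0) =
      (C.filter fun i => z i).card.choose d := by
    intro C
    simp_rw [Finset.prod_ite_zero, Finset.prod_const_one]
    rw [← Finset.sum_filter, Finset.sum_const, nsmul_eq_mul, mul_one, ← Finset.card_powersetCard]
    congr 2
    ext S
    simp only [Finset.mem_filter, Finset.mem_powersetCard, Finset.subset_iff]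
    grind
  rw [polyFun, esymmProd, ← cnt A, ← cnt B, Finset.sum_mul_sum, map_sum]
  refine Finset.sum_congr rfl fun S hS => ?_
  rw [map_sum]
  refine Finset.sum_congr rfl fun T hT => ?_
  rw [Finset.prod_union (hd.mono (Finset.mem_powersetCard.1 hS).1 (Finset.mem_powersetCard.1 hT).1)]
  simp

theorem le_gamma_two (l : ℕ) {ε : ℝ} (hε : 0 < ε) : ∃ N : ℕ,
    ∀ (ι : Type) [Fintype ι] [LinearOrder ι] (A B : Finset ι), Disjoint A B →
      A ∪ B = Finset.univ → N ≤ A.card → N ≤ B.card →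
      3 / 4 - ε ≤ gamma (2 * 2 ^ l) 2 (crossFun (2 ^ l) A B) := by
  obtain ⟨N, hN⟩ := exists_both_odd_bound l hε
  refine ⟨N, fun ι _ _ A B hd hu hA hB => ?_⟩
  refine le_trans ?_ ((isGreatest_gamma (2 * 2 ^ l) 2 (crossFun (2 ^ l) A B)).2
    ⟨_, esymmProd_mem (2 ^ l) 1 A B, rfl⟩)
  have hval : ∀ x y : ℕ, ¬ ((x.choose (2 ^ l) : ZMod 2) ≠ 0 ∧ (y.choose (2 ^ l) : ZMod 2) ≠ 0) →
      (if crossValue (2 ^ l) x y = 1 then (2 : ZMod 4) else 0) =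
        x.choose (2 ^ l) * y.choose (2 ^ l) := by
    -- If `C(x,d)` is even, one term of `crossValue` drops out and both sides equal `2 C(x,2d)
    -- C(y,d)` modulo 4.
    have half : ∀ x y : ℕ, (x.choose (2 ^ l) : ZMod 2) = 0 →
        (if crossValue (2 ^ l) x y = 1 then (2 : ZMod 4) else 0) =
          x.choose (2 ^ l) * y.choose (2 ^ l) := by
      intro x y h
      rw [crossValue, h, zero_mul, zero_add, choose_two_pow_eq_two_mul_choose h]
      rw [mul_assoc, ← Nat.cast_mul, ← Nat.cast_mul]
      generalize x.choose (2 * 2 ^ l) * y.choose (2 ^ l) = k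
      rcases Nat.even_or_odd' k with ⟨t, rfl | rfl⟩
      · have : (2 : ZMod 4) * 2 = 0 := by decide
        have h2 : (2 : ZMod 2) = 0 := by decide
        push_cast
        rw [← mul_assoc, this, h2]
        simp
      · have : (2 : ZMod 4) * 2 = 0 := by decide
        have h2 : (2 : ZMod 2) = 0 := by decide
        push_cast
        rw [mul_add, ← mul_assoc, this, h2]
        simp
    have hcomm : ∀ x y : ℕ, crossValue (2 ^ l) x y = crossValue (2 ^ l) y x := fun x y => by
      unfold crossValue; ring
    intro x y h
    by_cases hx : (x.choose (2 ^ l) : ZMod 2) = 0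
    · exact half x y hx
    · rw [hcomm, mul_comm]
      exact half y x (by tauto)
  have hagree : ∀ z : ι → Bool,
      1 - (if ((A.filter fun i => z i).card.choose (2 ^ l) : ZMod 2) ≠ 0 ∧
        ((B.filter fun i => z i).card.choose (2 ^ l) : ZMod 2) ≠ 0 then (1 : ℝ) else 0) ≤
      if lift 2 (crossFun (2 ^ l) A B) z =
        polyFun (esymmProd (ZMod (2 ^ (1 + 1))) (2 ^ l) A B) z then (1 : ℝ) else 0 := by
    intro z
    by_cases h : ((A.filter fun i => z i).card.choose (2 ^ l) : ZMod 2) ≠ 0 ∧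
        ((B.filter fun i => z i).card.choose (2 ^ l) : ZMod 2) ≠ 0
    · rw [if_pos h, sub_self]
      split_ifs <;> norm_num
    · rw [if_neg h, if_pos, sub_zero]
      rw [polyFun_esymmProd _ hd]
      refine Eq.trans ?_ (hval _ _ h)
      simp only [lift, crossFun, decide_eq_true_eq]
      rfl
  have hsum := Finset.sum_le_sum fun z (_ : z ∈ (Finset.univ : Finset (ι → Bool))) => hagree z
  rw [Finset.sum_sub_distrib, sum_cube hd hu fun X Y =>
    if (X.card.choose (2 ^ l) : ZMod 2) ≠ 0 ∧ (Y.card.choose (2 ^ l) : ZMod 2) ≠ 0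
      then (1 : ℝ) else 0] at hsum
  have htot : ∑ _z : ι → Bool, (1 : ℝ) = 2 ^ (A.card + B.card) := by
    rw [sum_cube hd hu fun _ _ => (1 : ℝ)]
    simp [pow_add]
  have := hN ι A B hA hB
  dsimp only
  rw [agr_eq hd hu, le_div_iff₀ (by positivity)]
  refine le_trans ?_ hsum
  rw [htot]
  linarith

end Cube

/-! ### Equal halves and the choice of the error sequence. -/

/-- The function `crossFun` on `{0,1}^{2n}`, the blocks being the two halves of the variables. -/
def halvesFun (d n : ℕ) : (Fin (2 * n) → Bool) → Bool :=
  crossFun d (Finset.univ.filter fun i => i.val < n) (Finset.univ.filter fun i => ¬ i.val < n)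

theorem eventually_halvesFun (l : ℕ) {ε : ℝ} (hε : 0 < ε) : ∀ᶠ n : ℕ in atTop,
    3 / 4 - ε ≤ gamma (2 * 2 ^ l) 2 (halvesFun (2 ^ l) n) ∧
      gamma (3 * 2 ^ l - 1) 1 (halvesFun (2 ^ l) n) ≤ 5 / 8 + ε := by
  obtain ⟨N₁, h₁⟩ := le_gamma_two l hε
  obtain ⟨N₂, h₂⟩ := gamma_one_le l hε
  filter_upwards [eventually_ge_atTop (max N₁ N₂)] with n hn
  have hA : (Finset.univ.filter fun i : Fin (2 * n) => i.val < n).card = n := by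
    rw [Fin.card_filter_val_lt]
    omega
  have hsum := Finset.card_filter_add_card_filter_not (s := (Finset.univ : Finset (Fin (2 * n))))
    (fun i => i.val < n)
  rw [hA, Finset.card_univ, Fintype.card_fin] at hsum
  have hd := Finset.disjoint_filter_filter_not (Finset.univ : Finset (Fin (2 * n)))
    Finset.univ (fun i => i.val < n)
  have hu := Finset.filter_union_filter_not_eq (fun i : Fin (2 * n) => i.val < n) Finset.univ
  exact ⟨h₁ _ _ _ hd hu (by omega) (by omega), h₂ _ _ _ hd hu (by omega) (by omega)⟩

theorem exists_rate (l : ℕ) : ∃ ε : ℕ → ℝ, Tendsto ε atTop (𝓝 0) ∧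
    ∀ᶠ n : ℕ in atTop,
      3 / 4 - ε n ≤ gamma (2 * 2 ^ l) 2 (halvesFun (2 ^ l) n) ∧
      gamma (3 * 2 ^ l - 1) 1 (halvesFun (2 ^ l) n) ≤ 5 / 8 + ε n ∧
      gamma (3 * 2 ^ l - 1) 1 (halvesFun (2 ^ l) n) <
        gamma (2 * 2 ^ l) 2 (halvesFun (2 ^ l) n) := by
  -- The error is the actual deficit in the two bounds, so both hold by construction and only
  -- convergence needs proof.
  refine ⟨fun n => max 0 (max (3 / 4 - gamma (2 * 2 ^ l) 2 (halvesFun (2 ^ l) n))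
    (gamma (3 * 2 ^ l - 1) 1 (halvesFun (2 ^ l) n) - 5 / 8)), ?_, ?_⟩
  · rw [Metric.tendsto_nhds]
    intro ε hε
    filter_upwards [eventually_halvesFun l (half_pos hε)] with n hn
    rw [Real.dist_0_eq_abs, abs_of_nonneg (le_max_left _ _)]
    refine lt_of_le_of_lt (max_le (by linarith) (max_le ?_ ?_)) (half_lt_self hε)
    · linarith [hn.1]
    · linarith [hn.2]
  -- Any constant below `1/16`, half the gap between `5/8` and `3/4`, gives the strict inequality.
  · filter_upwards [eventually_halvesFun l (show (0 : ℝ) < 1 / 32 by norm_num)] with n hn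
    have h1 := (le_max_left _ _).trans (le_max_right 0
      (max (3 / 4 - gamma (2 * 2 ^ l) 2 (halvesFun (2 ^ l) n))
        (gamma (3 * 2 ^ l - 1) 1 (halvesFun (2 ^ l) n) - 5 / 8)))
    have h2 := (le_max_right _ _).trans (le_max_right 0
      (max (3 / 4 - gamma (2 * 2 ^ l) 2 (halvesFun (2 ^ l) n))
        (gamma (3 * 2 ^ l - 1) 1 (halvesFun (2 ^ l) n) - 5 / 8)))
    refine ⟨by linarith, by linarith, by linarith [hn.1, hn.2]⟩

end BoolApprox

theorem mainTheorem3 :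
    (∀ d : ℕ, (∃ l : ℕ, d = 2 ^ l) →
      ∃ ε : ℕ → ℝ, Tendsto ε atTop (𝓝 0) ∧
        ∀ᶠ n : ℕ in atTop, ∃ F : (Fin (2 * n) → Bool) → Bool,
          3 / 4 - ε n ≤ BoolApprox.gamma (2 * d) 2 F ∧
          BoolApprox.gamma (3 * d - 1) 1 F ≤ 5 / 8 + ε n ∧
          BoolApprox.gamma (3 * d - 1) 1 F < BoolApprox.gamma (2 * d) 2 F) ∧
    (∀ᶠ n : ℕ in atTop, ∃ F : (Fin (2 * n) → Bool) → Bool,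
      BoolApprox.gamma 2 1 F < BoolApprox.gamma 2 2 F) := by
  constructor
  · rintro _ ⟨l, rfl⟩
    obtain ⟨ε, hε, h⟩ := BoolApprox.exists_rate l
    exact ⟨ε, hε, h.mono fun n hn => ⟨_, hn⟩⟩
  · obtain ⟨ε, -, h⟩ := BoolApprox.exists_rate 0
    exact h.mono fun n hn => ⟨_, hn.2.2⟩
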